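/- Let $d\ge 1$ be an integer and let $\alpha>0$ satisfy $\delta := d/\alpha = 1/2$. Let $P>0$, $N\ge 0$, $u>0$, $\tau>0$ satisfy $P u^{-\alpha} > \tau N$, i.e. the received signal-to-noise ratio $P u^{-\alpha}/N$ (read as $+\infty$ if $N=0$) exceeds the SINR threshold $\tau$. For every $\lambda \ge 0$ let $\Pi_{d,\lambda}$ be a homogeneous Poisson point process on $\mathbb R^d$ with intensity $\lambda$ (the empty process if $\lambda=0$), and let $$\Sigma_\lambda := \sum_{x\in \Pi_{d,\lambda}} |x|^{-\alpha},\qquad \mathsf{sinr}_\lambda := \frac{P u^{-\alpha}}{P\,\Sigma_\lambda + N},\qquad q(\lambda) := \mathbb P(\mathsf{sinr}_\lambda < \tau),$$ with $\mathsf{sinr}_\lambda=+\infty$ if the denominator is $0$. So $\Sigma_\lambda$ is the aggregate interference at the origin for unit powers and path loss without truncation ($\epsilon=0$), $P\,\Sigma_\lambda$ is the received interference power, and $q(\lambda)$ is the outage probability. Let $c_d$ denote the volume of the unit ball of $\mathbb R^d$, that is, $c_d = \pi^{d/2}/(d/2)!$ for even $d$ and $c_d=\frac{1}{d!}\pi^{(d-1)/2}2^d\left(\frac{d-1}{2}\right)!$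 for odd $d$. Let $F_Z$ be the standard normal distribution function and $F_Z^{-1}:(0,1)\to\mathbb R$ its inverse. The Lévy distribution with parameter $\gamma>0$ is the distribution on $(0,\infty)$ with density $\sqrt{\gamma/(2\pi)}\;e^{-\gamma/(2x)}\,x^{-3/2}$; for $\gamma=0$ it is the point mass at $0$. Then: 1. For every $\lambda\ge 0$, $\Sigma_\lambda$ is almost surely finite and has the Lévy distribution with parameter $\gamma=\frac{\pi}{2}(\lambda c_d)^2$, and $P\,\Sigma_\lambda$ has the Lévy distribution with parameter $P\gamma$. 2. For every $\lambda\ge 0$, $$q(\lambda) = 2F_Z\!\left(\sqrt{\frac{\pi/2}{\frac{u^{-2d}}{\tau}-\frac NP}}\;c_d\,\lambda\right)-1 .$$ 3. The function $q$ is continuous and strictly increasing on $[0,\infty)$, with range $[q(0),1)$. Hence the transmission capacity $\lambda(q^*) := q^{-1}(q^*)\,(1-q^*)$ is well defined for $q^*\in[q(0),1)$, and for all these $q^*$ $$\lambda(q^*) = \frac{1}{c_d}\sqrt{\frac{\frac{u^{-2d}}{\tau}-\frac NP}{\pi/2}}\;F_Z^{-1}\!\left(\frac{1+q^*}{2}\right)(1-q^*).$$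 -/

import Mathlib

open MeasureTheory ProbabilityTheory Set
open scoped NNReal ENNReal Nat

noncomputable section

/-- A homogeneous Poisson point process with intensity `lam` on `ℝ^d`: a random countable set of
points, with measurable counts, such that the number of points in every compact set is Poisson
with parameter `lam` times the volume, and the numbers of points in (finitely many) pairwise
disjoint Borel sets are independent. -/
structure IsPoissonPointProcess {Ω : Type*} [MeasurableSpace Ω] {d : ℕ}
    (X : Ω → Set (EuclideanSpace ℝ (Fin d))) (lam : ℝ≥0) (Pr : Measure Ω) : Prop where
  countable : ∀ ω, (X ω).Countable
  measurable_count : ∀ A : Set (EuclideanSpace ℝ (Fin d)), MeasurableSet A →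
    Measurable fun ω => (X ω ∩ A).encard
  count_law : ∀ A : Set (EuclideanSpace ℝ (Fin d)), IsCompact A →
    HasLaw (fun ω => (X ω ∩ A).encard)
      ((poissonMeasure (lam * (volume A).toNNReal)).map (fun n : ℕ => (n : ℕ∞))) Pr
  indep_count : ∀ (n : ℕ) (A : Fin n → Set (EuclideanSpace ℝ (Fin d))),
    (∀ i, MeasurableSet (A i)) → Pairwise (fun i j => Disjoint (A i) (A j)) →
    iIndepFun (fun i ω => (X ω ∩ A i).encard) Pr

/-- The power-law impulse response `r ↦ r ^ (-α)` truncated to `r ≥ ε`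
(for `ε = 0` it is infinite at `r = 0`). -/
def pathLoss (α ε r : ℝ) : ℝ≥0∞ :=
  if ε ≤ r then ENNReal.ofReal r ^ (-α) else 0

/-- The power-law shot noise at the origin generated by the points of `X`. -/
def shotNoise {d : ℕ} (α ε : ℝ) (X : Set (EuclideanSpace ℝ (Fin d))) : ℝ≥0∞ :=
  ∑' x : X, pathLoss α ε ‖(x : EuclideanSpace ℝ (Fin d))‖

/-- The received interference power at the origin when each point of `X` transmits with
power `P`. -/
def interferencePower {d : ℕ} (P α ε : ℝ) (X : Set (EuclideanSpace ℝ (Fin d))) : ℝ≥0∞ :=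
  ∑' x : X, ENNReal.ofReal P * pathLoss α ε ‖(x : EuclideanSpace ℝ (Fin d))‖

/-- The signal to interference plus noise ratio at a receiver at the origin whose transmitter is
at distance `u`. It is `∞` if there is neither interference nor noise. -/
def sinr {d : ℕ} (P N u α ε : ℝ) (X : Set (EuclideanSpace ℝ (Fin d))) : ℝ≥0∞ :=
  (ENNReal.ofReal P * pathLoss α ε u) / (interferencePower P α ε X + ENNReal.ofReal N)

/-- The outage probability: the probability that the SINR is below the threshold `τ`. -/
def outageProbability {Ω : Type*} [MeasurableSpace Ω] {d : ℕ} (P N u τ α ε : ℝ)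
    (X : Ω → Set (EuclideanSpace ℝ (Fin d))) (Pr : Measure Ω) : ℝ :=
  Pr.real {ω | sinr P N u α ε (X ω) < ENNReal.ofReal τ}

/-- The transmission capacity `q⁻¹(q*) (1 - q*)` for an outage probability function `q` of the
intensity. -/
def transmissionCapacity (q : ℝ≥0 → ℝ) (qstar : ℝ) : ℝ :=
  ((Function.invFun q qstar : ℝ≥0) : ℝ) * (1 - qstar)

/-- The volume `c_d` of the unit ball of `ℝ^d`. -/
def unitBallVolume (d : ℕ) : ℝ :=
  if Even d then Real.pi ^ (d / 2) / ((d / 2)! : ℝ)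
  else 1 / (d ! : ℝ) * Real.pi ^ ((d - 1) / 2) * 2 ^ d * (((d - 1) / 2)! : ℝ)

/-- The density of the Lévy distribution with parameter `γ`. -/
def levyPDF (γ x : ℝ) : ℝ :=
  if 0 < x then
    Real.sqrt (γ / (2 * Real.pi)) * Real.exp (-γ / (2 * x)) / x ^ (3 / 2 : ℝ)
  else 0

/-- The Lévy distribution with parameter `γ ≥ 0`; for `γ = 0` it is the point mass at `0`. -/
def levyMeasure (γ : ℝ) : Measure ℝ :=
  if γ = 0 then Measure.dirac 0
  else volume.withDensity fun x => ENNReal.ofReal (levyPDF γ x)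

/-- The standard normal cumulative distribution function. -/
def stdNormalCDF (x : ℝ) : ℝ := cdf (gaussianReal 0 1) x

/-- The inverse of the standard normal cumulative distribution function, on `(0, 1)`. -/
def stdNormalInvCDF (p : ℝ) : ℝ := Function.invFun stdNormalCDF p

/-- The standard normal cumulative distribution function is a bijection of `ℝ` onto `(0, 1)`, so
that its inverse is meaningful there. -/
theorem bijOn_stdNormalCDF : BijOn stdNormalCDF univ (Ioo 0 1) := by
  have hpos : ∀ a b : ℝ, a < b → 0 < (gaussianReal 0 1) (Ioc a b) := by
    intro a b hab
    rw [pos_iff_ne_zero]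
    intro h0
    have h1 := gaussianReal_absolutelyContinuous' (0 : ℝ) (one_ne_zero : (1 : ℝ≥0) ≠ 0) h0
    rw [Real.volume_Ioc, ENNReal.ofReal_eq_zero] at h1
    linarith
  have hsm : StrictMono stdNormalCDF := by
    intro a b hab
    have h1 := hpos a b hab
    rw [← measure_cdf (gaussianReal 0 1), StieltjesFunction.measure_Ioc, ENNReal.ofReal_pos] at h1
    unfold stdNormalCDF
    linarith
  have : NullSingletonClass (gaussianReal 0 1) :=
    nullSingletonClass_gaussianReal one_ne_zero
  have hc : Continuous stdNormalCDF := by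
    rw [continuous_iff_continuousAt]
    intro x
    unfold stdNormalCDF
    have hm : Monotone (cdf (gaussianReal 0 1)) := monotone_cdf _
    have h0 : (gaussianReal 0 1) {x} = 0 := measure_singleton x
    rw [← measure_cdf (gaussianReal 0 1), StieltjesFunction.measure_singleton,
      ENNReal.ofReal_eq_zero] at h0
    rw [hm.continuousAt_iff_leftLim_eq_rightLim, StieltjesFunction.rightLim_eq]
    exact le_antisymm (hm.leftLim_le le_rfl) (by linarith)
  refine ⟨fun x _ => ⟨?_, ?_⟩, hsm.injective.injOn, ?_⟩
  · have h1 : stdNormalCDF (x - 1) < stdNormalCDF x := hsm (by linarith)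
    have h2 : 0 ≤ stdNormalCDF (x - 1) := cdf_nonneg _ _
    linarith
  · have h1 : stdNormalCDF x < stdNormalCDF (x + 1) := hsm (by linarith)
    have h2 : stdNormalCDF (x + 1) ≤ 1 := cdf_le_one _ _
    linarith
  · intro p hp
    obtain ⟨a, ha⟩ := ((tendsto_cdf_atBot (gaussianReal 0 1)).eventually
      (eventually_lt_nhds hp.1)).exists
    obtain ⟨b, hb⟩ := ((tendsto_cdf_atTop (gaussianReal 0 1)).eventually
      (eventually_gt_nhds hp.2)).exists
    obtain ⟨x, hx⟩ := mem_range_of_exists_le_of_exists_ge hc ⟨a, ha.le⟩ ⟨b, hb.le⟩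
    exact ⟨x, mem_univ x, hx⟩

end

/-! The condition δ = 1/2 means α = 2d, so |x|^{-α} = (|x|^d)^{-2}. In the coordinate t = |x|^d,
Lebesgue measure becomes c_d dt, so the shot noise is Σ t_i^{-2} over a Poisson process of rate λ
c_d on the half-line. Its Laplace transform at m is exp(-λ c_d ∫ (1 - e^{-m/t²}) dt) = exp(-λ c_d
√(πm)).

For Z standard normal, E exp(-s/Z²) = e^{-√(2s)}, so the same transform belongs to γ/Z² with γ =
(π/2)(λ c_d)². Laplace transforms at the natural numbers determine laws on [0,∞], hence the two laws
agree (`map_tsum_invSq`). Working on [0,∞] makes almost sure finiteness a consequence rather than a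
prerequisite. The law of γ/Z² is the Lévy law (`levyMeasure_eq_map_gaussianReal`), including γ = 0.

Outage is the event that the shot noise exceeds a positive threshold s, that is |Z| < √(γ/s). Its
probability is 2 F_Z(κλ) - 1 with κ > 0. Invertibility and the capacity formula follow from the
corresponding properties of F_Z.

The Laplace transform is computed by discretization: rounding t up to a dyadic grid turns the sum
into a finite combination of independent Poisson counts of shells
(`integral_expNeg_tsum_dyadicInvSq`). The exponent is then a Riemann sum, and refining the grid
gives the integral. -/

open Filter Topology

/-! ### Laplace transforms of measures on [0, ∞]. -/

/-- The function `x ↦ exp (-x)` on `[0, ∞]`, vanishing at `∞`. -/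
noncomputable def expNeg (x : ℝ≥0∞) : ℝ := (EReal.exp (-(x : EReal))).toReal

theorem expNeg_top : expNeg ∞ = 0 := by simp [expNeg]

theorem expNeg_ofReal {x : ℝ} (hx : 0 ≤ x) : expNeg (ENNReal.ofReal x) = Real.exp (-x) := by
  rw [expNeg, EReal.coe_ennreal_ofReal, max_eq_left hx, ← EReal.coe_neg, EReal.exp_coe,
    ENNReal.toReal_ofReal (Real.exp_nonneg _)]

theorem expNeg_of_ne_top {x : ℝ≥0∞} (hx : x ≠ ∞) : expNeg x = Real.exp (-x.toReal) := by
  rw [← expNeg_ofReal ENNReal.toReal_nonneg, ENNReal.ofReal_toReal hx]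

theorem expNeg_zero : expNeg 0 = 1 := by simp [expNeg]

theorem expNeg_nonneg (x : ℝ≥0∞) : 0 ≤ expNeg x := ENNReal.toReal_nonneg

theorem expNeg_le_one (x : ℝ≥0∞) : expNeg x ≤ 1 := by
  rcases eq_or_ne x ∞ with rfl | hx
  · simp [expNeg_top]
  · rw [expNeg_of_ne_top hx]
    simp

theorem continuous_expNeg : Continuous expNeg := by
  have h : ∀ x : ℝ≥0∞, EReal.exp (-(x : EReal)) ≠ ∞ := by
    intro x
    simp [EReal.exp_eq_top_iff]
  rw [continuous_iff_continuousAt]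
  intro x
  exact ContinuousAt.comp (f := fun x : ℝ≥0∞ => EReal.exp (-(x : EReal)))
    (ENNReal.continuousAt_toReal (h x)) (EReal.expHomeomorph.continuous.comp
    (continuous_neg.comp continuous_coe_ennreal_ereal)).continuousAt

theorem expNeg_injective : Function.Injective expNeg := by
  intro x y h
  rcases eq_or_ne x ∞ with rfl | hx <;> rcases eq_or_ne y ∞ with rfl | hy
  · rfl
  · rw [expNeg_top, expNeg_of_ne_top hy] at h
    exact absurd h (Real.exp_pos _).ne
  · rw [expNeg_top, expNeg_of_ne_top hx] at h
    exact absurd h (Real.exp_pos _).ne'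
  · rw [expNeg_of_ne_top hx, expNeg_of_ne_top hy, Real.exp_eq_exp, neg_inj] at h
    exact (ENNReal.toReal_eq_toReal_iff' hx hy).1 h

theorem expNeg_add (x y : ℝ≥0∞) : expNeg (x + y) = expNeg x * expNeg y := by
  rcases eq_or_ne x ∞ with rfl | hx
  · simp [expNeg_top]
  rcases eq_or_ne y ∞ with rfl | hy
  · simp [expNeg_top]
  rw [expNeg_of_ne_top hx, expNeg_of_ne_top hy, expNeg_of_ne_top (by simp [hx, hy]),
    ENNReal.toReal_add hx hy, neg_add, Real.exp_add]

theorem expNeg_sum {ι : Type*} (s : Finset ι) (f : ι → ℝ≥0∞) :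
    expNeg (∑ i ∈ s, f i) = ∏ i ∈ s, expNeg (f i) := by
  classical
  induction s using Finset.induction_on with
  | empty => simp [expNeg_zero]
  | insert a s ha ih => rw [Finset.sum_insert ha, Finset.prod_insert ha, expNeg_add, ih]

theorem expNeg_natCast_mul (n : ℕ) (x : ℝ≥0∞) : expNeg (n * x) = expNeg x ^ n := by
  simpa using expNeg_sum (Finset.range n) fun _ => x

open scoped BoundedContinuousFunction in
/-- A finite measure on `[0, ∞]` is determined by its Laplace transform at the natural numbers. -/
theorem ext_of_integral_expNeg_pow {μ ν : Measure ℝ≥0∞} [IsFiniteMeasure μ] [IsFiniteMeasure ν]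
    (h : ∀ n : ℕ, ∫ x, expNeg x ^ n ∂μ = ∫ x, expNeg x ^ n ∂ν) : μ = ν := by
  let e : ℝ≥0∞ →ᵇ ℝ := BoundedContinuousFunction.mkOfCompact ⟨expNeg, continuous_expNeg⟩
  -- Stone–Weierstrass: polynomials in the injective function `e` separate points, and their
  -- integrals are linear combinations of the given moments.
  let A : StarSubalgebra ℝ (ℝ≥0∞ →ᵇ ℝ) :=
    { Algebra.adjoin ℝ {e} with
      star_mem' := by
        intro a ha
        have : star a = a := by ext; simp
        rwa [this] }
  refine ext_of_forall_mem_subalgebra_integral_eq_of_polish (𝕜 := ℝ) (A := A) ?_ ?_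
  · intro x y hxy
    refine ⟨expNeg, ⟨⟨expNeg, continuous_expNeg⟩, ⟨e, Algebra.self_mem_adjoin_singleton ℝ e, ?_⟩, rfl⟩,
      fun h => hxy (expNeg_injective h)⟩
    ext
    rfl
  · intro g hg
    have hg' : g ∈ Algebra.adjoin ℝ {e} := hg
    rw [Algebra.adjoin_singleton_eq_range_aeval] at hg'
    obtain ⟨p, rfl⟩ := hg'
    induction p using Polynomial.induction_on' with
    | add p q hp hq =>
      have hm : ∀ p : Polynomial ℝ, Polynomial.aeval e p ∈ A := fun p => by
        change Polynomial.aeval e p ∈ Algebra.adjoin ℝ {e}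
        rw [Algebra.adjoin_singleton_eq_range_aeval]
        exact ⟨p, rfl⟩
      have hi : ∀ (κ : Measure ℝ≥0∞) [IsFiniteMeasure κ] (f : ℝ≥0∞ →ᵇ ℝ),
        Integrable (fun x => f x) κ := fun κ _ f => f.integrable κ
      simp only [map_add, BoundedContinuousFunction.coe_add, Pi.add_apply] at *
      rw [integral_add (hi _ _) (hi _ _), integral_add (hi _ _) (hi _ _)]
      congr 1
      · exact hp (hm p)
      · exact hq (hm q)
    | monomial n a =>
      have : ∀ x, (Polynomial.aeval e (Polynomial.monomial n a)) x = a * expNeg x ^ n := by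
        intro x
        simp [Polynomial.aeval_monomial, e]
      change ∫ x, (Polynomial.aeval e (Polynomial.monomial n a)) x ∂μ =
        ∫ x, (Polynomial.aeval e (Polynomial.monomial n a)) x ∂ν
      simp only [this]
      rw [integral_const_mul, integral_const_mul, h]

/-! ### Gaussian-type integrals via explicit antiderivatives. -/

theorem integrable_exp_neg_sq : Integrable fun x : ℝ => Real.exp (-x ^ 2) := by
  simpa using integrable_exp_neg_mul_sq one_pos

theorem integral_Ioi_exp_neg_sq : ∫ x in Ioi (0 : ℝ), Real.exp (-x ^ 2) = √Real.pi / 2 := by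
  simpa using integral_gaussian_Ioi 1

theorem hasDerivAt_integral_exp_neg_sq (x : ℝ) :
    HasDerivAt (fun y => ∫ t in (0 : ℝ)..y, Real.exp (-t ^ 2)) (Real.exp (-x ^ 2)) x :=
  intervalIntegral.integral_hasDerivAt_right (by
    apply Continuous.intervalIntegrable; fun_prop)
    (Continuous.stronglyMeasurableAtFilter (by fun_prop) _ _) (by fun_prop)

theorem tendsto_integral_exp_neg_sq_atTop :
    Tendsto (fun y => ∫ t in (0 : ℝ)..y, Real.exp (-t ^ 2)) atTop (𝓝 (√Real.pi / 2)) := by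
  rw [← integral_Ioi_exp_neg_sq]
  exact intervalIntegral_tendsto_integral_Ioi _ integrable_exp_neg_sq.integrableOn tendsto_id

theorem tendsto_integral_exp_neg_sq_atBot :
    Tendsto (fun y => ∫ t in (0 : ℝ)..y, Real.exp (-t ^ 2)) atBot (𝓝 (-(√Real.pi / 2))) := by
  refine (tendsto_integral_exp_neg_sq_atTop.comp tendsto_neg_atBot_atTop).neg.congr fun y => ?_
  have := intervalIntegral.integral_comp_neg (a := 0) (b := y) fun t : ℝ => Real.exp (-t ^ 2)
  simp only [even_two, Even.neg_pow, neg_zero] at this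
  rw [this, intervalIntegral.integral_symm, Function.comp_apply]

/-- Only a right limit at `a` is asked of `f`: the antiderivatives below contain quotients by the
variable, whose value at 0 is a meaningless default. Redefining `f` at `a` restores continuity. -/
theorem integrableOn_and_integral_Ioi_of_hasDerivAt_of_nonneg {f f' : ℝ → ℝ} {a l m : ℝ}
    (hderiv : ∀ x ∈ Ioi a, HasDerivAt f (f' x) x) (hpos : ∀ x ∈ Ioi a, 0 ≤ f' x)
    (ha : Tendsto f (𝓝[>] a) (𝓝 l)) (htop : Tendsto f atTop (𝓝 m)) :
    IntegrableOn f' (Ioi a) ∧ ∫ x in Ioi a, f' x = m - l := by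
  classical
  let g := Function.update f a l
  have hg : ∀ x ∈ Ioi a, g =ᶠ[𝓝 x] f := fun x hx => by
    filter_upwards [Ioi_mem_nhds hx] with y hy
    exact Function.update_of_ne (ne_of_gt hy) _ _
  have hd : ∀ x ∈ Ioi a, HasDerivAt g (f' x) x := fun x hx =>
    (hderiv x hx).congr_of_eventuallyEq (hg x hx)
  have ht : Tendsto g atTop (𝓝 m) := by
    refine htop.congr' ?_
    filter_upwards [Ioi_mem_atTop a] with y hy
    exact (Function.update_of_ne (ne_of_gt hy) _ _).symm
  have hc : ContinuousWithinAt g (Ici a) a := by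
    rw [continuousWithinAt_update_same]
    simpa using ha
  refine ⟨integrableOn_Ioi_deriv_of_nonneg hc hd hpos ht, ?_⟩
  rw [integral_Ioi_of_hasDerivAt_of_nonneg hc hd hpos ht]
  simp [g]

theorem tendsto_mul_one_sub_exp_neg_div_sq_atTop (s : ℝ) (hs : 0 ≤ s) :
    Tendsto (fun t : ℝ => t * (1 - Real.exp (-(s / t ^ 2)))) atTop (𝓝 0) := by
  have h : Tendsto (fun t : ℝ => s / t) atTop (𝓝 0) := tendsto_const_nhds.div_atTop tendsto_id
  refine squeeze_zero' ?_ ?_ h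
  · filter_upwards [Ioi_mem_atTop 0] with t ht
    have : Real.exp (-(s / t ^ 2)) ≤ 1 := Real.exp_le_one_iff.2 (by
      have : 0 ≤ s / t ^ 2 := by positivity
      linarith)
    exact mul_nonneg (le_of_lt ht) (by linarith)
  · filter_upwards [Ioi_mem_atTop 0] with t ht
    have h1 := Real.one_sub_le_exp_neg (s / t ^ 2)
    have ht : 0 < t := ht
    calc t * (1 - Real.exp (-(s / t ^ 2))) ≤ t * (s / t ^ 2) := by gcongr; linarith
      _ = s / t := by field_simp

theorem tendsto_mul_one_sub_exp_neg_div_sq_zero (s : ℝ) (hs : 0 ≤ s) :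
    Tendsto (fun t : ℝ => t * (1 - Real.exp (-(s / t ^ 2)))) (𝓝[>] 0) (𝓝 0) := by
  have h : Tendsto (fun t : ℝ => t) (𝓝[>] 0) (𝓝 0) := tendsto_id.mono_left nhdsWithin_le_nhds
  refine squeeze_zero' ?_ ?_ h
  · filter_upwards [self_mem_nhdsWithin] with t ht
    have : Real.exp (-(s / t ^ 2)) ≤ 1 := Real.exp_le_one_iff.2 (by
      have : 0 ≤ s / t ^ 2 := by positivity
      linarith)
    exact mul_nonneg (le_of_lt ht) (by linarith)
  · filter_upwards [self_mem_nhdsWithin] with t ht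
    have h1 := Real.exp_pos (-(s / t ^ 2))
    have ht : 0 < t := ht
    nlinarith

/-- Integration by parts leaves ∫ (2s/t²) e^{-s/t²} dt, which the substitution w = √s/t turns into a
Gaussian integral. This gives the antiderivative used. -/
theorem integral_one_sub_exp_neg_div_sq {s : ℝ} (hs : 0 < s) :
    IntegrableOn (fun t : ℝ => 1 - Real.exp (-(s / t ^ 2))) (Ioi 0) ∧
      ∫ t in Ioi (0 : ℝ), (1 - Real.exp (-(s / t ^ 2))) = √(Real.pi * s) := by
  let E : ℝ → ℝ := fun y => ∫ t in (0 : ℝ)..y, Real.exp (-t ^ 2)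
  have hs' : 0 < √s := Real.sqrt_pos.2 hs
  have hss : √s ^ 2 = s := Real.sq_sqrt hs.le
  have key := integrableOn_and_integral_Ioi_of_hasDerivAt_of_nonneg (a := 0)
    (f := fun t => t * (1 - Real.exp (-(s / t ^ 2))) - 2 * √s * E (√s / t))
    (f' := fun t => 1 - Real.exp (-(s / t ^ 2))) (l := 0 - 2 * √s * (√Real.pi / 2))
    (m := 0 - 2 * √s * E 0) ?_ ?_ ?_ ?_
  · refine ⟨key.1, key.2.trans ?_⟩
    have : E 0 = 0 := by simp [E]
    rw [this, Real.sqrt_mul Real.pi_pos.le]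
    ring
  · intro t ht
    have ht : t ≠ 0 := ne_of_gt ht
    have h1 : HasDerivAt (fun t : ℝ => s / t ^ 2) (-(2 * s / t ^ 3)) t := by
      have := ((hasDerivAt_const t s).div (hasDerivAt_pow 2 t) (pow_ne_zero 2 ht))
      refine this.congr_deriv ?_
      field_simp
      simp
      ring
    have h2 : HasDerivAt (fun t : ℝ => √s / t) (-(√s / t ^ 2)) t := by
      have := ((hasDerivAt_const t √s).div (hasDerivAt_id t) ht)
      refine this.congr_deriv ?_
      simp [neg_div]
    have h3 := (hasDerivAt_integral_exp_neg_sq (√s / t)).comp t h2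
    have h4 := ((hasDerivAt_id t).mul (h1.neg.exp.const_sub 1)).sub (h3.const_mul (2 * √s))
    refine h4.congr_deriv ?_
    rw [div_pow, hss]
    simp only [id]
    generalize Real.exp (-(s / t ^ 2)) = e
    field_simp
    rw [hss]
    ring
  · intro t ht
    have : Real.exp (-(s / t ^ 2)) ≤ 1 := Real.exp_le_one_iff.2 (by
      have : 0 ≤ s / t ^ 2 := by positivity
      linarith)
    linarith
  · refine (tendsto_mul_one_sub_exp_neg_div_sq_zero s hs.le).sub (Tendsto.const_mul _ ?_)
    refine tendsto_integral_exp_neg_sq_atTop.comp ?_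
    exact tendsto_inv_nhdsGT_zero.const_mul_atTop hs'
  · refine (tendsto_mul_one_sub_exp_neg_div_sq_atTop s hs.le).sub (Tendsto.const_mul _ ?_)
    refine ((hasDerivAt_integral_exp_neg_sq 0).continuousAt.tendsto).comp ?_
    exact tendsto_const_nhds.div_atTop tendsto_id

/-- Since (x ± b/x)² = x² + b²/x² ± 2b, the derivatives of e^{±2b} E(x ± b/x) are the integrand
times 1 ∓ b/x². Averaging cancels the b/x² terms. -/
theorem integral_exp_neg_sq_sub_div_sq {b : ℝ} (hb : 0 < b) :
    IntegrableOn (fun x : ℝ => Real.exp (-x ^ 2 - b ^ 2 / x ^ 2)) (Ioi 0) ∧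
      ∫ x in Ioi (0 : ℝ), Real.exp (-x ^ 2 - b ^ 2 / x ^ 2) =
        √Real.pi / 2 * Real.exp (-(2 * b)) := by
  let E : ℝ → ℝ := fun y => ∫ t in (0 : ℝ)..y, Real.exp (-t ^ 2)
  have hinv : Tendsto (fun x : ℝ => b / x) (𝓝[>] 0) atTop :=
    tendsto_inv_nhdsGT_zero.const_mul_atTop hb
  have hid : Tendsto (fun x : ℝ => x) (𝓝[>] 0) (𝓝 0) := tendsto_id.mono_left nhdsWithin_le_nhds
  have hdiv : Tendsto (fun x : ℝ => b / x) atTop (𝓝 0) := tendsto_const_nhds.div_atTop tendsto_id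
  have key := integrableOn_and_integral_Ioi_of_hasDerivAt_of_nonneg (a := 0)
    (f := fun x => (Real.exp (2 * b) * E (x + b / x) + Real.exp (-(2 * b)) * E (x - b / x)) / 2)
    (f' := fun x => Real.exp (-x ^ 2 - b ^ 2 / x ^ 2))
    (l := (Real.exp (2 * b) * (√Real.pi / 2) + Real.exp (-(2 * b)) * (-(√Real.pi / 2))) / 2)
    (m := (Real.exp (2 * b) * (√Real.pi / 2) + Real.exp (-(2 * b)) * (√Real.pi / 2)) / 2)
    ?_ ?_ ?_ ?_
  · refine ⟨key.1, key.2.trans ?_⟩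
    ring
  · intro x hx
    have hx : x ≠ 0 := ne_of_gt hx
    have h2 : HasDerivAt (fun x : ℝ => b / x) (-(b / x ^ 2)) x := by
      have := ((hasDerivAt_const x b).div (hasDerivAt_id x) hx)
      refine this.congr_deriv ?_
      simp [neg_div]
    have h3 := (hasDerivAt_integral_exp_neg_sq (x + b / x)).comp x ((hasDerivAt_id x).add h2)
    have h4 := (hasDerivAt_integral_exp_neg_sq (x - b / x)).comp x ((hasDerivAt_id x).sub h2)
    refine (((h3.const_mul (Real.exp (2 * b))).add
      (h4.const_mul (Real.exp (-(2 * b))))).div_const 2).congr_deriv ?_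
    rw [← mul_assoc, ← mul_assoc, ← Real.exp_add, ← Real.exp_add]
    have e1 : 2 * b + -(x + b / x) ^ 2 = -x ^ 2 - b ^ 2 / x ^ 2 := by field_simp; ring
    have e2 : -(2 * b) + -(x - b / x) ^ 2 = -x ^ 2 - b ^ 2 / x ^ 2 := by field_simp; ring
    rw [e1, e2]
    ring
  · intro x _
    exact (Real.exp_pos _).le
  · refine Tendsto.div_const (Tendsto.add (Tendsto.const_mul _ ?_) (Tendsto.const_mul _ ?_)) _
    · exact tendsto_integral_exp_neg_sq_atTop.comp (hid.add_atTop hinv)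
    · refine tendsto_integral_exp_neg_sq_atBot.comp ?_
      simp_rw [sub_eq_add_neg]
      exact hid.add_atBot (tendsto_neg_atTop_atBot.comp hinv)
  · refine Tendsto.div_const (Tendsto.add (Tendsto.const_mul _ ?_) (Tendsto.const_mul _ ?_)) _
    · exact tendsto_integral_exp_neg_sq_atTop.comp (tendsto_id.atTop_add hdiv)
    · refine tendsto_integral_exp_neg_sq_atTop.comp ?_
      simp_rw [sub_eq_add_neg]
      exact tendsto_id.atTop_add hdiv.neg

/-- The Laplace transform of the inverse square of a standard normal variable. -/
theorem integral_exp_neg_div_sq_gaussianReal {s : ℝ} (hs : 0 ≤ s) :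
    ∫ z, Real.exp (-(s / z ^ 2)) ∂(gaussianReal 0 1) = Real.exp (-√(2 * s)) := by
  rcases hs.eq_or_lt with rfl | hs
  · simp
  rw [integral_gaussianReal_eq_integral_smul one_ne_zero]
  have hb : 0 < √(s / 2) := Real.sqrt_pos.2 (by positivity)
  have h2 : (√2 : ℝ) ^ 2 = 2 := Real.sq_sqrt (by norm_num)
  have hcomp := integral_comp_mul_left_Ioi
    (fun x => Real.exp (-x ^ 2 - √(s / 2) ^ 2 / x ^ 2)) 0 (b := (√2)⁻¹) (by positivity)
  rw [mul_zero, (integral_exp_neg_sq_sub_div_sq hb).2] at hcomp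
  -- With x = |z|/√2 and b = √(s/2), the exponent -z²/2 - s/z² is -x² - b²/x². The absolute value
  -- prepares folding the line onto the half-line.
  have hpt : ∀ z : ℝ, gaussianPDFReal 0 1 z • Real.exp (-(s / z ^ 2)) =
      (√(2 * Real.pi))⁻¹ *
        Real.exp (-((√2)⁻¹ * |z|) ^ 2 - √(s / 2) ^ 2 / ((√2)⁻¹ * |z|) ^ 2) := by
    intro z
    rw [gaussianPDFReal, smul_eq_mul, mul_assoc, ← Real.exp_add, mul_pow, inv_pow, h2,
      Real.sq_sqrt (by positivity), sq_abs]
    simp only [NNReal.coe_one, mul_one, sub_zero]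
    congr 2
    field_simp
    ring
  simp_rw [hpt]
  rw [integral_const_mul, integral_comp_abs
    (f := fun z => Real.exp (-((√2)⁻¹ * z) ^ 2 - √(s / 2) ^ 2 / ((√2)⁻¹ * z) ^ 2)), hcomp]
  have e : 2 * √(s / 2) = √(2 * s) := by
    rw [show 2 * s = 2 ^ 2 * (s / 2) by ring, Real.sqrt_mul (by norm_num),
      Real.sqrt_sq (by norm_num)]
  rw [e, Real.sqrt_mul (by norm_num : (0:ℝ) ≤ 2), inv_inv, smul_eq_mul]
  have : 0 < √Real.pi := Real.sqrt_pos.2 Real.pi_pos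
  field_simp

/-! ### Volume of the unit ball and the normal distribution function. -/

theorem unitBallVolume_eq (d : ℕ) (hd : 1 ≤ d) :
    volume (Metric.ball (0 : EuclideanSpace ℝ (Fin d)) 1) = ENNReal.ofReal (unitBallVolume d) := by
  have : Nonempty (Fin d) := ⟨⟨0, hd⟩⟩
  unfold unitBallVolume
  rcases Nat.even_or_odd' d with ⟨k, rfl | rfl⟩
  · rw [InnerProductSpace.volume_ball_of_dim_even (k := k) (by simp)]
    simp
  · rw [InnerProductSpace.volume_ball_of_dim_odd (k := k) (by simp)]
    have h1 : ¬ Even (2 * k + 1) := by simp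
    rw [if_neg h1, ENNReal.ofReal_one, one_pow, one_mul, Nat.add_sub_cancel, finrank_euclideanSpace_fin,
      Nat.mul_div_cancel_left k two_pos]
    congr 1
    have h2 : (2 * k + 1)! = (2 * k + 1)‼ * (2 ^ k * k !) := by
      rw [Nat.factorial_eq_mul_doubleFactorial, Nat.doubleFactorial_two_mul]
    rw [h2]
    have h3 : ((2 * k + 1)‼ : ℝ) ≠ 0 := by exact_mod_cast (Nat.doubleFactorial_pos _).ne'
    have h4 : ((k ! : ℕ) : ℝ) ≠ 0 := by exact_mod_cast k.factorial_ne_zero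
    push_cast
    field_simp
    ring

theorem unitBallVolume_pos (d : ℕ) : 0 < unitBallVolume d := by
  unfold unitBallVolume
  split_ifs <;> positivity

theorem strictMono_stdNormalCDF : StrictMono stdNormalCDF :=
  (monotone_cdf (gaussianReal 0 1)).strictMono_of_injective
    (injOn_univ.1 bijOn_stdNormalCDF.injOn)

/-- A monotone function with open image has no jumps. -/
theorem continuous_stdNormalCDF : Continuous stdNormalCDF := by
  rw [continuous_iff_continuousAt]
  intro x
  have hs : (stdNormalCDF '' univ) ∈ 𝓝 (stdNormalCDF x) := by
    rw [bijOn_stdNormalCDF.image_eq]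
    exact isOpen_Ioo.mem_nhds (bijOn_stdNormalCDF.mapsTo (mem_univ x))
  exact (strictMono_stdNormalCDF.strictMonoOn univ).continuousAt_of_image_mem_nhds univ_mem hs

theorem stdNormalCDF_neg (x : ℝ) : stdNormalCDF (-x) = 1 - stdNormalCDF x := by
  have : NullSingletonClass (gaussianReal 0 1) := nullSingletonClass_gaussianReal one_ne_zero
  have h1 : (gaussianReal 0 1).real (Ici x) = (gaussianReal 0 1).real (Iic (-x)) := by
    have h := gaussianReal_map_neg (μ := 0) (v := 1)
    rw [neg_zero] at h
    conv_lhs => rw [← h]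
    rw [map_measureReal_apply measurable_neg measurableSet_Ici]
    congr 1
    ext y
    simp
  rw [stdNormalCDF, stdNormalCDF, cdf_eq_real, cdf_eq_real, ← h1,
    ← measureReal_congr (Ioi_ae_eq_Ici (μ := gaussianReal 0 1) (a := x)), ← compl_Iic,
    probReal_compl_eq_one_sub measurableSet_Iic]

theorem stdNormalCDF_zero : stdNormalCDF 0 = 1 / 2 := by
  have := stdNormalCDF_neg 0
  rw [neg_zero] at this
  linarith

theorem gaussianReal_real_Ioo_neg {r : ℝ} (hr : 0 ≤ r) :
    (gaussianReal 0 1).real (Ioo (-r) r) = 2 * stdNormalCDF r - 1 := by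
  have : NullSingletonClass (gaussianReal 0 1) := nullSingletonClass_gaussianReal one_ne_zero
  rw [measureReal_congr (Ioo_ae_eq_Ioc (μ := gaussianReal 0 1)),
    show Ioc (-r) r = Iic r \ Iic (-r) by ext; simp [and_comm],
    measureReal_sdiff (Iic_subset_Iic.2 (by linarith)) measurableSet_Iic, ← cdf_eq_real,
    ← cdf_eq_real]
  change stdNormalCDF r - stdNormalCDF (-r) = _
  rw [stdNormalCDF_neg]
  ring

/-! ### The Lévy distribution as an inverse square Gaussian. -/

/-- The Lévy distribution with parameter `γ` is the law of `γ / Z ^ 2` for a standard normal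
variable `Z`. -/
theorem levyMeasure_eq_map_gaussianReal {γ : ℝ} (hγ : 0 ≤ γ) :
    levyMeasure γ = (gaussianReal 0 1).map fun z => γ / z ^ 2 := by
  rcases hγ.eq_or_lt with rfl | hγ
  · simp [levyMeasure]
  rw [levyMeasure, if_neg hγ.ne']
  have hsγ : 0 < √γ := Real.sqrt_pos.2 hγ
  have hm : Measurable fun z : ℝ => γ / z ^ 2 := by fun_prop
  refine Measure.ext_of_lintegral _ fun f hf => ?_
  have hl : Measurable fun x => ENNReal.ofReal (levyPDF γ x) := by
    refine ENNReal.measurable_ofReal.comp (Measurable.ite measurableSet_Ioi ?_ measurable_const)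
    fun_prop
  rw [lintegral_withDensity_eq_lintegral_mul _ hl hf, lintegral_map hf hm,
    gaussianReal_of_var_ne_zero _ one_ne_zero,
    lintegral_withDensity_eq_lintegral_mul _ (measurable_gaussianPDF 0 1)
      (g := fun z => f (γ / z ^ 2)) (hf.comp hm)]
  have hsymm : ∀ g : ℝ → ℝ≥0∞, (∀ x, g (-x) = g x) →
      ∫⁻ x, g x = 2 * ∫⁻ x in Ioi (0 : ℝ), g x := by
    intro g hg
    have h1 : ∫⁻ x in Iio (0 : ℝ), g x = ∫⁻ x in Ioi (0 : ℝ), g x := by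
      have := (Measure.measurePreserving_neg (volume : Measure ℝ)).setLIntegral_comp_preimage_emb
        (MeasurableEquiv.neg ℝ).measurableEmbedding g (Ioi 0)
      rw [← this]
      simp [hg]
    rw [← lintegral_add_compl g (measurableSet_Ioi (a := (0 : ℝ))), compl_Ioi,
      setLIntegral_congr Iio_ae_eq_Iic.symm, h1, two_mul]
  have hz : ∫⁻ x, ((fun x => ENNReal.ofReal (levyPDF γ x)) * f) x =
      ∫⁻ x in Ioi (0 : ℝ), ENNReal.ofReal (levyPDF γ x) * f x := by
    rw [← lintegral_indicator measurableSet_Ioi]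
    congr 1
    ext x
    by_cases hx : 0 < x
    · simp [hx]
    · simp [hx, levyPDF]
  rw [hz, hsymm]
  swap
  · intro x
    simp [gaussianPDF, gaussianPDFReal]
  -- After folding by evenness, the change of variables is z = √γ x^{-1/2}, the inverse of z ↦ γ/z²
  -- on the positive half-line.
  have himage : (fun x : ℝ => √γ * x ^ (-(1 / 2) : ℝ)) '' Ioi 0 = Ioi 0 := by
    ext y
    constructor
    · rintro ⟨x, hx, rfl⟩
      exact mul_pos hsγ (Real.rpow_pos_of_pos hx _)
    · intro hy
      have hy : 0 < y := hy
      refine ⟨(y / √γ) ^ (-2 : ℝ), Real.rpow_pos_of_pos (by positivity) _, ?_⟩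
      simp only
      rw [← Real.rpow_mul (by positivity)]
      norm_num
      field_simp
  have hderiv : ∀ x ∈ Ioi (0 : ℝ), HasDerivWithinAt (fun x : ℝ => √γ * x ^ (-(1 / 2) : ℝ))
      (√γ * (-(1 / 2) * x ^ (-(1 / 2) - 1 : ℝ))) (Ioi 0) x := fun x hx =>
    ((Real.hasDerivAt_rpow_const (Or.inl (ne_of_gt hx))).const_mul _).hasDerivWithinAt
  have hinj : InjOn (fun x : ℝ => √γ * x ^ (-(1 / 2) : ℝ)) (Ioi 0) := by
    intro x hx y hy h
    have h : √γ * x ^ (-(1 / 2) : ℝ) = √γ * y ^ (-(1 / 2) : ℝ) := h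
    exact (Real.rpow_left_inj (le_of_lt hx) (le_of_lt hy) (by norm_num)).1
      (mul_left_cancel₀ hsγ.ne' h)
  conv_rhs => rw [← himage]
  rw [lintegral_image_eq_lintegral_abs_deriv_mul measurableSet_Ioi hderiv hinj,
    ← lintegral_const_mul' _ _ (by simp)]
  refine setLIntegral_congr_fun measurableSet_Ioi fun x hx => ?_
  have hx : 0 < x := hx
  have hsq : (√γ * x ^ (-(1 / 2) : ℝ)) ^ 2 = γ / x := by
    rw [mul_pow, Real.sq_sqrt hγ.le, ← Real.rpow_natCast, ← Real.rpow_mul hx.le]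
    norm_num [Real.rpow_neg_one, div_eq_mul_inv]
  have hγx : γ / (γ / x) = x := by field_simp
  simp only [Pi.mul_apply, hsq, hγx]
  rw [← mul_assoc, ← mul_assoc]
  congr 1
  rw [gaussianPDF, show (2 : ℝ≥0∞) = ENNReal.ofReal 2 by simp, ← ENNReal.ofReal_mul (by norm_num),
    ← ENNReal.ofReal_mul (by positivity)]
  congr 1
  rw [levyPDF, if_pos hx, gaussianPDFReal, abs_mul, abs_mul, abs_neg, abs_of_pos hsγ,
    abs_of_pos (Real.rpow_pos_of_pos hx _)]
  simp only [sub_zero, NNReal.coe_one, mul_one, hsq]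
  rw [show (-(1 / 2) - 1 : ℝ) = -(3 / 2) by norm_num, Real.rpow_neg hx.le, Real.sqrt_div hγ.le,
    abs_of_pos (by norm_num : (0 : ℝ) < 1 / 2),
    show -(γ / x) / 2 = -γ / (2 * x) by field_simp]
  field_simp

/-! ### Riemann sums and the dyadic approximation. -/

/-- Monotone convergence for the counting measure on the discrete σ-algebra. -/
theorem tsum_tendsto_of_monotone {ι : Type*} {f : ℕ → ι → ℝ≥0∞} {F : ι → ℝ≥0∞}
    (hmono : ∀ i, Monotone fun n => f n i)
    (hlim : ∀ i, Tendsto (fun n => f n i) atTop (𝓝 (F i))) :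
    Tendsto (fun n => ∑' i, f n i) atTop (𝓝 (∑' i, F i)) := by
  let _ : MeasurableSpace ι := ⊤
  have := lintegral_tendsto_of_tendsto_of_monotone (μ := Measure.count) (f := f) (F := F)
    (fun n => (measurable_from_top).aemeasurable) (ae_of_all _ hmono) (ae_of_all _ hlim)
  simpa only [lintegral_count] using this

theorem tsum_coe_indicator_const {E : Type*} (X A : Set E) (c : ℝ≥0∞) :
    ∑' x : X, A.indicator (fun _ => c) (x : E) = (X ∩ A).encard * c := by
  rw [tsum_subtype X (A.indicator fun _ => c), indicator_indicator,
    ← tsum_subtype (X ∩ A) fun _ => c, ENNReal.tsum_set_const]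

/-- The 4^n cells of mesh 2^{-n} cover [0, 2^n], so refinement and exhaustion happen together. By
monotonicity the right-endpoint sum lies between the integral over [0, 2^n] and that integral minus
2^{-n} ψ(0). -/
theorem tendsto_mul_sum_of_antitone {ψ : ℝ → ℝ} (hψ : Antitone ψ) (hnn : ∀ t, 0 ≤ ψ t)
    (hint : IntegrableOn ψ (Ioi 0)) :
    Tendsto (fun n : ℕ => ((2 : ℝ) ^ n)⁻¹ * ∑ k ∈ Finset.range (4 ^ n), ψ ((k + 1) * (2 ^ n)⁻¹))
      atTop (𝓝 (∫ t in Ioi (0 : ℝ), ψ t)) := by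
  have h2 : Tendsto (fun n : ℕ => (2 : ℝ) ^ n) atTop atTop :=
    tendsto_pow_atTop_atTop_of_one_lt one_lt_two
  have hI := intervalIntegral_tendsto_integral_Ioi 0 hint h2
  have hz : Tendsto (fun n : ℕ => ((2 : ℝ) ^ n)⁻¹ * ψ 0) atTop (𝓝 0) := by
    simpa using (tendsto_inv_atTop_zero.comp h2).mul_const (ψ 0)
  have hI' : Tendsto (fun n : ℕ => (∫ t in (0 : ℝ)..2 ^ n, ψ t) - ((2 : ℝ) ^ n)⁻¹ * ψ 0) atTop
      (𝓝 (∫ t in Ioi (0 : ℝ), ψ t)) := by simpa using hI.sub hz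
  have hF : ∀ n : ℕ, Antitone fun y : ℝ => ψ (y * (2 ^ n)⁻¹) := fun n x y hxy =>
    hψ (mul_le_mul_of_nonneg_right hxy (by positivity))
  have hcomp : ∀ n : ℕ, ∫ y in (0 : ℝ)..0 + ((4 ^ n : ℕ) : ℝ), ψ (y * (2 ^ n)⁻¹) =
      2 ^ n * ∫ t in (0 : ℝ)..2 ^ n, ψ t := by
    intro n
    rw [intervalIntegral.integral_comp_mul_right ψ (by positivity)]
    have : (0 + ((4 ^ n : ℕ) : ℝ)) * (2 ^ n)⁻¹ = 2 ^ n := by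
      push_cast
      rw [zero_add, show (4 : ℝ) = 2 * 2 by norm_num, mul_pow]
      field_simp
    rw [this, zero_mul, inv_inv, smul_eq_mul]
  refine tendsto_of_tendsto_of_tendsto_of_le_of_le hI' hI (fun n => ?_) (fun n => ?_)
  · have h := ((hF n).antitoneOn (Icc 0 (0 + ((4 ^ n : ℕ) : ℝ)))).integral_le_sum
    rw [hcomp n] at h
    have h1 := Finset.sum_range_succ (fun i : ℕ => ψ ((0 + (i : ℝ)) * (2 ^ n)⁻¹)) (4 ^ n)
    have h3 := Finset.sum_range_succ' (fun i : ℕ => ψ ((0 + (i : ℝ)) * (2 ^ n)⁻¹)) (4 ^ n)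
    have h4 := hnn ((0 + ((4 ^ n : ℕ) : ℝ)) * (2 ^ n)⁻¹)
    simp only [zero_add, Nat.cast_zero, zero_mul, Nat.cast_add, Nat.cast_one] at h h1 h3 h4
    have h5 : 2 ^ n * (∫ t in (0 : ℝ)..2 ^ n, ψ t) ≤
        (∑ k ∈ Finset.range (4 ^ n), ψ ((k + 1) * (2 ^ n)⁻¹)) + ψ 0 := by linarith
    have h6 := mul_le_mul_of_nonneg_left h5 (by positivity : (0 : ℝ) ≤ (2 ^ n)⁻¹)
    rw [← mul_assoc, inv_mul_cancel₀ (by positivity), one_mul, mul_add] at h6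
    simp only
    linarith
  · have h := ((hF n).antitoneOn (Icc 0 (0 + ((4 ^ n : ℕ) : ℝ)))).sum_le_integral
    rw [hcomp n] at h
    simp only [zero_add, Nat.cast_add, Nat.cast_one] at h
    have h6 := mul_le_mul_of_nonneg_left h (by positivity : (0 : ℝ) ≤ (2 ^ n)⁻¹)
    rwa [← mul_assoc ((2 : ℝ) ^ n)⁻¹ (2 ^ n), inv_mul_cancel₀ (by positivity), one_mul] at h6

theorem tendsto_mul_sum_one_sub_exp {s : ℝ} (hs : 0 ≤ s) :
    Tendsto (fun n : ℕ => ((2 : ℝ) ^ n)⁻¹ * ∑ k ∈ Finset.range (4 ^ n),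
      (1 - Real.exp (-(s / ((k + 1) * (2 ^ n)⁻¹) ^ 2)))) atTop (𝓝 √(Real.pi * s)) := by
  rcases hs.eq_or_lt with rfl | hs
  · simp
  -- The integrand evaluates to 0 at t = 0 because division by zero gives 0, which breaks
  -- monotonicity. The value 1 there is its right limit.
  let ψ : ℝ → ℝ := fun t => if t ≤ 0 then 1 else 1 - Real.exp (-(s / t ^ 2))
  have hpos : ∀ t : ℝ, 0 < t → ψ t = 1 - Real.exp (-(s / t ^ 2)) := fun t ht =>
    if_neg (not_le.2 ht)
  have hle : ∀ t, ψ t ≤ 1 := by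
    intro t
    simp only [ψ]
    split_ifs
    · exact le_rfl
    · linarith [Real.exp_pos (-(s / t ^ 2))]
  have hnn : ∀ t, 0 ≤ ψ t := by
    intro t
    simp only [ψ]
    split_ifs
    · exact zero_le_one
    · have : Real.exp (-(s / t ^ 2)) ≤ 1 := Real.exp_le_one_iff.2 (by
        have : 0 ≤ s / t ^ 2 := by positivity
        linarith)
      linarith
  have hanti : Antitone ψ := by
    intro x y hxy
    rcases le_or_gt x 0 with hx | hx
    · rw [show ψ x = 1 from if_pos hx]
      exact hle y
    · have hy := hx.trans_le hxy
      rw [hpos x hx, hpos y hy]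
      gcongr
  have hcongr : EqOn (fun t : ℝ => 1 - Real.exp (-(s / t ^ 2))) ψ (Ioi 0) := fun t ht =>
    (hpos t ht).symm
  have hint := integral_one_sub_exp_neg_div_sq hs
  rw [setIntegral_congr_fun measurableSet_Ioi hcongr,
    integrableOn_congr_fun hcongr measurableSet_Ioi] at hint
  rw [← hint.2]
  refine (tendsto_mul_sum_of_antitone hanti hnn hint.1).congr fun n => ?_
  congr 1
  exact Finset.sum_congr rfl fun k _ => hpos _ (by positivity)

/-- The dyadic approximation from below of `v ↦ v⁻²` on `(0, 2 ^ n]`. -/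
noncomputable def dyadicInvSq (n : ℕ) (v : ℝ) : ℝ≥0∞ :=
  if 0 < v ∧ v ≤ 2 ^ n then ENNReal.ofReal ((⌈v * 2 ^ n⌉₊ * (2 ^ n)⁻¹) ^ 2)⁻¹ else 0

/-- Since ⌈2x⌉ ≤ 2⌈x⌉, refining the grid can only lower the rounded-up point, hence raise its
inverse square. The support also grows. -/
theorem monotone_dyadicInvSq (v : ℝ) : Monotone fun n => dyadicInvSq n v := by
  refine monotone_nat_of_le_succ fun n => ?_
  unfold dyadicInvSq
  by_cases h : 0 < v ∧ v ≤ 2 ^ n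
  · have h2 : 0 < v ∧ v ≤ 2 ^ (n + 1) := ⟨h.1, h.2.trans (by gcongr <;> simp)⟩
    rw [if_pos h, if_pos h2]
    have hc : (0 : ℝ) < ⌈v * 2 ^ (n + 1)⌉₊ := by
      have := h.1
      exact_mod_cast Nat.ceil_pos.2 (by positivity)
    have hle : ⌈v * 2 ^ (n + 1)⌉₊ ≤ 2 * ⌈v * 2 ^ n⌉₊ := by
      rw [Nat.ceil_le]
      push_cast
      have := Nat.le_ceil (v * 2 ^ n)
      rw [pow_succ]
      linarith
    have hle' : (⌈v * 2 ^ (n + 1)⌉₊ : ℝ) ≤ 2 * ⌈v * 2 ^ n⌉₊ := by exact_mod_cast hle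
    apply ENNReal.ofReal_le_ofReal
    have : (⌈v * 2 ^ (n + 1)⌉₊ : ℝ) * (2 ^ (n + 1))⁻¹ ≤ ⌈v * 2 ^ n⌉₊ * (2 ^ n)⁻¹ := by
      calc (⌈v * 2 ^ (n + 1)⌉₊ : ℝ) * (2 ^ (n + 1))⁻¹
          ≤ 2 * ⌈v * 2 ^ n⌉₊ * (2 ^ (n + 1))⁻¹ := by gcongr
        _ = ⌈v * 2 ^ n⌉₊ * (2 ^ n)⁻¹ := by
          rw [pow_succ]
          field_simp
    gcongr
  · rw [if_neg h]
    exact zero_le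

theorem tendsto_dyadicInvSq {v : ℝ} (hv : 0 ≤ v) :
    Tendsto (fun n => dyadicInvSq n v) atTop (𝓝 (ENNReal.ofReal (v ^ 2)⁻¹)) := by
  -- At v = 0 the limit is 0, by the convention 0⁻¹ = 0 in ℝ.
  rcases hv.eq_or_lt with rfl | hv
  · simp [dyadicInvSq]
  have h2 : Tendsto (fun n : ℕ => (2 : ℝ) ^ n) atTop atTop :=
    tendsto_pow_atTop_atTop_of_one_lt one_lt_two
  have h := (tendsto_nat_ceil_mul_div_atTop hv.le).comp h2
  have h' := ENNReal.tendsto_ofReal ((h.pow 2).inv₀ (by positivity))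
  refine h'.congr' ?_
  filter_upwards [h2.eventually_ge_atTop v] with n hn
  simp [dyadicInvSq, hv, hn, div_eq_mul_inv]

/-- Rounding up is constant on the cells, which are half-open so as to be disjoint. This
step-function form reduces a sum over points to counts in shells. -/
theorem dyadicInvSq_eq_sum (n : ℕ) (v : ℝ) :
    dyadicInvSq n v = ∑ k ∈ Finset.range (4 ^ n),
      (Ioc ((k : ℝ) * (2 ^ n)⁻¹) ((k + 1) * (2 ^ n)⁻¹)).indicator
        (fun _ => ENNReal.ofReal (((k + 1) * (2 ^ n)⁻¹) ^ 2)⁻¹) v := by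
  have hp : (0 : ℝ) < 2 ^ n := by positivity
  have h4 : (4 : ℝ) ^ n = 2 ^ n * 2 ^ n := by rw [← mul_pow]; norm_num
  have hmem : ∀ k : ℕ, v ∈ Ioc ((k : ℝ) * (2 ^ n)⁻¹) ((k + 1) * (2 ^ n)⁻¹) ↔
      (k : ℝ) < v * 2 ^ n ∧ v * 2 ^ n ≤ k + 1 := by
    intro k
    rw [mem_Ioc, ← div_eq_mul_inv, ← div_eq_mul_inv, div_lt_iff₀ hp, le_div_iff₀ hp]
  unfold dyadicInvSq
  split_ifs with h
  · have hvp : 0 < v * 2 ^ n := mul_pos h.1 hp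
    obtain ⟨m, hm⟩ : ∃ m, ⌈v * 2 ^ n⌉₊ = m + 1 :=
      Nat.exists_eq_succ_of_ne_zero (Nat.ceil_pos.2 hvp).ne'
    have hm' := (Nat.ceil_eq_iff (Nat.succ_ne_zero m)).1 hm
    simp only [Nat.succ_eq_add_one, Nat.add_sub_cancel, Nat.cast_add, Nat.cast_one] at hm'
    rw [Finset.sum_eq_single m]
    · rw [indicator_of_mem ((hmem m).2 hm'), hm]
      push_cast
      rfl
    · intro k _ hk
      refine indicator_of_notMem (fun hv => hk ?_) _
      have hv' := (hmem k).1 hv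
      have : ⌈v * 2 ^ n⌉₊ = k + 1 := by
        rw [Nat.ceil_eq_iff (Nat.succ_ne_zero k)]
        simpa using hv'
      omega
    · intro hmr
      exfalso
      rw [Finset.mem_range, not_lt] at hmr
      have h5 : (4 : ℝ) ^ n ≤ m := by exact_mod_cast hmr
      have h6 : v * 2 ^ n ≤ 2 ^ n * 2 ^ n := mul_le_mul_of_nonneg_right h.2 hp.le
      linarith [hm'.1]
  · symm
    refine Finset.sum_eq_zero fun k hk => indicator_of_notMem (fun hv => h ?_) _
    have hv' := (hmem k).1 hv
    have h0 : (0 : ℝ) ≤ k := k.cast_nonneg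
    have hk' : (k : ℝ) + 1 ≤ 4 ^ n := by exact_mod_cast Finset.mem_range.1 hk
    refine ⟨?_, ?_⟩
    · exact pos_of_mul_pos_left (h0.trans_lt hv'.1) hp.le
    · rw [h4] at hk'
      exact le_of_mul_le_mul_right (hv'.2.trans hk') hp

/-! ### Shells in the coordinate |x|^d. -/

section volume

variable {d : ℕ}

theorem setOf_norm_pow_le (hd : 1 ≤ d) {b : ℝ} (hb : 0 ≤ b) :
    {x : EuclideanSpace ℝ (Fin d) | ‖x‖ ^ d ≤ b} = Metric.closedBall 0 (b ^ (d : ℝ)⁻¹) := by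
  ext x
  have hd0 : d ≠ 0 := by omega
  have h : (b ^ (d : ℝ)⁻¹) ^ d = b := Real.rpow_inv_natCast_pow hb hd0
  rw [mem_ofPred_eq, mem_closedBall_zero_iff, ← pow_le_pow_iff_left₀ (norm_nonneg x)
    (Real.rpow_nonneg hb _) hd0, h]

theorem setOf_norm_pow_lt (hd : 1 ≤ d) {b : ℝ} (hb : 0 ≤ b) :
    {x : EuclideanSpace ℝ (Fin d) | ‖x‖ ^ d < b} = Metric.ball 0 (b ^ (d : ℝ)⁻¹) := by
  ext x
  have hd0 : d ≠ 0 := by omega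
  have h : (b ^ (d : ℝ)⁻¹) ^ d = b := Real.rpow_inv_natCast_pow hb hd0
  rw [mem_ofPred_eq, mem_ball_zero_iff, ← pow_lt_pow_iff_left₀ (norm_nonneg x)
    (Real.rpow_nonneg hb _) hd0, h]

theorem nontrivial_euclideanSpace_fin (hd : 1 ≤ d) : Nontrivial (EuclideanSpace ℝ (Fin d)) :=
  Module.nontrivial_of_finrank_pos (R := ℝ) (by rw [finrank_euclideanSpace_fin]; omega)

theorem volume_setOf_norm_pow_lt (hd : 1 ≤ d) {b : ℝ} (hb : 0 ≤ b) :
    volume {x : EuclideanSpace ℝ (Fin d) | ‖x‖ ^ d < b} =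
      ENNReal.ofReal (b * unitBallVolume d) := by
  have hd0 : d ≠ 0 := by omega
  have := nontrivial_euclideanSpace_fin hd
  rw [setOf_norm_pow_lt hd hb, Measure.addHaar_ball _ _ (Real.rpow_nonneg hb _),
    unitBallVolume_eq d hd, finrank_euclideanSpace_fin, Real.rpow_inv_natCast_pow hb hd0,
    ENNReal.ofReal_mul hb]

theorem volume_setOf_norm_pow_le (hd : 1 ≤ d) {b : ℝ} (hb : 0 ≤ b) :
    volume {x : EuclideanSpace ℝ (Fin d) | ‖x‖ ^ d ≤ b} =
      ENNReal.ofReal (b * unitBallVolume d) := by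
  have := nontrivial_euclideanSpace_fin hd
  rw [← volume_setOf_norm_pow_lt hd hb, setOf_norm_pow_le hd hb, setOf_norm_pow_lt hd hb,
    Measure.addHaar_closedBall_eq_addHaar_ball]

/-- The shell of the points whose norm, raised to the dimension, lies between two bounds. -/
def closedShell (d : ℕ) (a b : ℝ) : Set (EuclideanSpace ℝ (Fin d)) := {x | ‖x‖ ^ d ∈ Icc a b}

theorem isCompact_closedShell (hd : 1 ≤ d) {a b : ℝ} (hb : 0 ≤ b) :
    IsCompact (closedShell d a b) := by
  have h : closedShell d a b = Metric.closedBall 0 (b ^ (d : ℝ)⁻¹) ∩ {x | a ≤ ‖x‖ ^ d} := by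
    rw [← setOf_norm_pow_le hd hb]
    ext x
    simp [closedShell, and_comm]
  rw [h]
  exact (isCompact_closedBall _ _).inter_right (isClosed_le (by fun_prop) (by fun_prop))

theorem volume_closedShell (hd : 1 ≤ d) {a b : ℝ} (ha : 0 ≤ a) (hab : a ≤ b) :
    volume (closedShell d a b) = ENNReal.ofReal ((b - a) * unitBallVolume d) := by
  have h : closedShell d a b = {x : EuclideanSpace ℝ (Fin d) | ‖x‖ ^ d ≤ b} \ {x | ‖x‖ ^ d < a} := by
    ext x
    simp [closedShell, and_comm]
  rw [h, measure_sdiff, volume_setOf_norm_pow_le hd (ha.trans hab),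
    volume_setOf_norm_pow_lt hd ha, ← ENNReal.ofReal_sub, sub_mul]
  · exact mul_nonneg ha (unitBallVolume_pos d).le
  · intro x hx
    exact (le_of_lt hx).trans hab
  · exact (measurableSet_lt (by fun_prop) (by fun_prop)).nullMeasurableSet
  · rw [volume_setOf_norm_pow_lt hd ha]
    exact ENNReal.ofReal_ne_top

end volume

/-! ### Laplace transform of the shot noise. -/

theorem integral_pow_poissonMeasure (r : ℝ≥0) (x : ℝ) :
    ∫ n, x ^ n ∂(poissonMeasure r) = Real.exp (-(r * (1 - x))) := by
  rw [integral_poissonMeasure]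
  have h : ∀ n : ℕ, (Real.exp (-(r : ℝ)) * r ^ n / n !) • x ^ n =
      Real.exp (-(r : ℝ)) * ((r * x) ^ n / n !) := by
    intro n
    rw [smul_eq_mul, mul_pow]
    ring
  simp_rw [h]
  rw [tsum_mul_left, ← congrFun NormedSpace.exp_eq_tsum_div (r * x),
    ← congrFun Real.exp_eq_exp_ℝ, ← Real.exp_add]
  congr 1
  ring

namespace IsPoissonPointProcess

variable {Ω : Type*} [MeasurableSpace Ω] {d : ℕ} {X : Ω → Set (EuclideanSpace ℝ (Fin d))}
  {lam : ℝ≥0} {Pr : Measure Ω}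

/-- The Poisson law with parameter 0 is concentrated at 0. This discards spheres and the origin. -/
theorem ae_inter_eq_empty (hX : IsPoissonPointProcess X lam Pr)
    {A : Set (EuclideanSpace ℝ (Fin d))} (hA : IsCompact A) (h0 : volume A = 0) :
    ∀ᵐ ω ∂Pr, X ω ∩ A = ∅ := by
  have h := hX.count_law A hA
  rw [h0] at h
  have hP : (poissonMeasure (lam * (0 : ℝ≥0∞).toNNReal)).map (fun n : ℕ => (n : ℕ∞)) {0}ᶜ = 0 := by
    rw [Measure.map_apply measurable_from_top (measurableSet_singleton _).compl]
    have hpre : (fun n : ℕ => (n : ℕ∞)) ⁻¹' {0}ᶜ = {0}ᶜ := by ext; simp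
    rw [hpre, prob_compl_eq_zero_iff (measurableSet_singleton _), poissonMeasure_singleton]
    simp
  have h1 := h.measure_eq (p := fun n => n ∈ ({0}ᶜ : Set ℕ∞)) (measurableSet_singleton _).compl
  simp only [ofPred_mem_eq, hP] at h1
  rw [ae_iff]
  convert! h1 using 3 with ω
  simp [encard_eq_zero]

/-- The count law is given for compact sets only, whereas disjointness needs half-open shells. The
two differ by a sphere, almost surely free of points. The rest is the Poisson generating function at
e^{-c}. -/
theorem integral_expNeg_shell (hX : IsPoissonPointProcess X lam Pr) (hd : 1 ≤ d) {a b c : ℝ}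
    (ha : 0 ≤ a) (hab : a ≤ b) (hc : 0 ≤ c) :
    ∫ ω, expNeg ((X ω ∩ {x | ‖x‖ ^ d ∈ Ioc a b}).encard * ENNReal.ofReal c) ∂Pr =
      Real.exp (-(lam * ((b - a) * unitBallVolume d) * (1 - Real.exp (-c)))) := by
  have hnull := hX.ae_inter_eq_empty (isCompact_closedShell hd ha (a := a)) (by
    rw [volume_closedShell hd ha le_rfl]; simp)
  have hae : (fun ω => expNeg ((X ω ∩ {x | ‖x‖ ^ d ∈ Ioc a b}).encard * ENNReal.ofReal c)) =ᵐ[Pr]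
      fun ω => expNeg ((X ω ∩ closedShell d a b).encard * ENNReal.ofReal c) := by
    filter_upwards [hnull] with ω hω
    congr 4
    ext x
    refine and_congr_right fun hx => ?_
    have hne : ‖x‖ ^ d ≠ a := by
      intro h
      have : x ∈ X ω ∩ closedShell d a a := ⟨hx, by simp [closedShell, h]⟩
      rw [hω] at this
      exact this
    simp only [closedShell, mem_ofPred_eq, mem_Ioc, mem_Icc]
    exact ⟨fun h => ⟨h.1.le, h.2⟩, fun h => ⟨lt_of_le_of_ne h.1 hne.symm, h.2⟩⟩
  rw [integral_congr_ae hae]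
  have hlaw := hX.count_law _ (isCompact_closedShell (a := a) hd (ha.trans hab))
  have h1 := hlaw.integral_comp (f := fun n : ℕ∞ => expNeg (n * ENNReal.ofReal c))
    (measurable_from_top).aestronglyMeasurable
  have hc' : ∀ n : ℕ, expNeg ((n : ℕ∞) * ENNReal.ofReal c) = Real.exp (-c) ^ n := by
    intro n
    rw [ENat.toENNReal_coe, expNeg_natCast_mul, expNeg_ofReal hc]
  refine h1.trans ?_
  rw [integral_map measurable_from_top.aemeasurable (measurable_from_top).aestronglyMeasurable]
  simp only [hc']
  rw [integral_pow_poissonMeasure, volume_closedShell hd ha hab]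
  congr 3
  rw [NNReal.coe_mul]
  congr 1
  exact ENNReal.toReal_ofReal (mul_nonneg (sub_nonneg.2 hab) (unitBallVolume_pos d).le)

end IsPoissonPointProcess

section

variable {d : ℕ}

theorem tsum_dyadicInvSq (X : Set (EuclideanSpace ℝ (Fin d))) (n : ℕ) :
    ∑' x : X, dyadicInvSq n (‖(x : EuclideanSpace ℝ (Fin d))‖ ^ d) =
      ∑ k ∈ Finset.range (4 ^ n),
        ((X ∩ {x | ‖x‖ ^ d ∈ Ioc ((k : ℝ) * (2 ^ n)⁻¹) ((k + 1) * (2 ^ n)⁻¹)}).encard : ℝ≥0∞) *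
          ENNReal.ofReal (((k + 1) * (2 ^ n)⁻¹) ^ 2)⁻¹ := by
  simp_rw [dyadicInvSq_eq_sum]
  rw [Summable.tsum_finsetSum fun _ _ => ENNReal.summable]
  refine Finset.sum_congr rfl fun k _ => ?_
  rw [← tsum_coe_indicator_const]
  rfl

theorem measurableSet_norm_pow_mem (s : Set ℝ) (hs : MeasurableSet s) :
    MeasurableSet {x : EuclideanSpace ℝ (Fin d) | ‖x‖ ^ d ∈ s} :=
  (by fun_prop : Measurable fun x : EuclideanSpace ℝ (Fin d) => ‖x‖ ^ d) hs

theorem tendsto_tsum_dyadicInvSq (X : Set (EuclideanSpace ℝ (Fin d))) :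
    Tendsto (fun n => ∑' x : X, dyadicInvSq n (‖(x : EuclideanSpace ℝ (Fin d))‖ ^ d)) atTop
      (𝓝 (∑' x : X, ENNReal.ofReal ((‖(x : EuclideanSpace ℝ (Fin d))‖ ^ d) ^ 2)⁻¹)) :=
  tsum_tendsto_of_monotone (fun _ => monotone_dyadicInvSq _)
    fun _ => tendsto_dyadicInvSq (by positivity)

end

namespace IsPoissonPointProcess

variable {Ω : Type*} [MeasurableSpace Ω] {d : ℕ} {X : Ω → Set (EuclideanSpace ℝ (Fin d))}
  {lam : ℝ≥0} {Pr : Measure Ω}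

theorem measurable_tsum_dyadicInvSq (hX : IsPoissonPointProcess X lam Pr) (n : ℕ) :
    Measurable fun ω => ∑' x : X ω, dyadicInvSq n (‖(x : EuclideanSpace ℝ (Fin d))‖ ^ d) := by
  simp_rw [tsum_dyadicInvSq]
  refine Finset.measurable_fun_sum _ fun k _ => Measurable.mul_const ?_ _
  exact measurable_from_top.comp
    (hX.measurable_count _ (measurableSet_norm_pow_mem _ measurableSet_Ioc))

/-- Measurability is known only for counts, so it is inherited as a pointwise limit of finite
combinations of them. -/
theorem measurable_tsum_invSq (hX : IsPoissonPointProcess X lam Pr) :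
    Measurable fun ω =>
      ∑' x : X ω, ENNReal.ofReal ((‖(x : EuclideanSpace ℝ (Fin d))‖ ^ d) ^ 2)⁻¹ :=
  measurable_of_tendsto_metrizable hX.measurable_tsum_dyadicInvSq
    (tendsto_pi_nhds.2 fun ω => tendsto_tsum_dyadicInvSq (X ω))

/-- Counts in disjoint shells are independent, so the transform factorizes. All shells have the same
volume 2^{-n} c_d, and the exponents add up to a Riemann sum of 1 - e^{-m/t²}. -/
theorem integral_expNeg_tsum_dyadicInvSq (hX : IsPoissonPointProcess X lam Pr) (hd : 1 ≤ d)
    (n m : ℕ) :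
    ∫ ω, expNeg (∑' x : X ω, dyadicInvSq n (‖(x : EuclideanSpace ℝ (Fin d))‖ ^ d)) ^ m ∂Pr =
      Real.exp (-(lam * unitBallVolume d * ((2 ^ n)⁻¹ * ∑ k ∈ Finset.range (4 ^ n),
        (1 - Real.exp (-(m / ((k + 1) * (2 ^ n)⁻¹) ^ 2)))))) := by
  have h : ∀ ω, expNeg (∑' x : X ω, dyadicInvSq n (‖(x : EuclideanSpace ℝ (Fin d))‖ ^ d)) ^ m =
      ∏ k : Fin (4 ^ n), expNeg (((X ω ∩ {x | ‖x‖ ^ d ∈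
        Ioc ((k : ℝ) * (2 ^ n)⁻¹) ((k + 1) * (2 ^ n)⁻¹)}).encard : ℝ≥0∞) *
          ENNReal.ofReal (m / ((k + 1) * (2 ^ n)⁻¹) ^ 2)) := by
    intro ω
    rw [tsum_dyadicInvSq, ← expNeg_natCast_mul, Finset.mul_sum, expNeg_sum, Finset.prod_range]
    refine Finset.prod_congr rfl fun k _ => ?_
    rw [mul_left_comm, div_eq_mul_inv, ENNReal.ofReal_mul (Nat.cast_nonneg m),
      ENNReal.ofReal_natCast]
  simp_rw [h]
  have hind := hX.indep_count (4 ^ n)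
    (fun k => {x | ‖x‖ ^ d ∈ Ioc ((k : ℝ) * (2 ^ n)⁻¹) ((k + 1) * (2 ^ n)⁻¹)})
    (fun k => measurableSet_norm_pow_mem _ measurableSet_Ioc) (by
      intro i j hij
      refine Set.disjoint_left.2 ?_
      rintro x ⟨hi1, hi2⟩ ⟨hj1, hj2⟩
      have hp : (0 : ℝ) < (2 ^ n)⁻¹ := by positivity
      have h1 : (i : ℝ) < j + 1 := lt_of_mul_lt_mul_right (hi1.trans_le hj2) hp.le
      have h2 : (j : ℝ) < i + 1 := lt_of_mul_lt_mul_right (hj1.trans_le hi2) hp.le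
      refine hij (Fin.ext ?_)
      have h1' : (i : ℕ) < j + 1 := by exact_mod_cast h1
      have h2' : (j : ℕ) < i + 1 := by exact_mod_cast h2
      omega)
  have hprod := hind.integral_fun_prod_comp
    (f := fun (k : Fin (4 ^ n)) (c : ℕ∞) =>
      expNeg ((c : ℝ≥0∞) * ENNReal.ofReal (m / ((k + 1) * (2 ^ n)⁻¹) ^ 2)))
    (fun k => (hX.measurable_count _
      (measurableSet_norm_pow_mem _ measurableSet_Ioc)).aemeasurable)
    (fun k => measurable_from_top.aestronglyMeasurable)
  refine hprod.trans ?_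
  have hk : ∀ k : Fin (4 ^ n), _ := fun k => hX.integral_expNeg_shell hd
    (a := (k : ℝ) * (2 ^ n)⁻¹) (b := (k + 1) * (2 ^ n)⁻¹)
    (c := m / ((k + 1) * (2 ^ n)⁻¹) ^ 2) (by positivity) (by gcongr; simp) (by positivity)
  rw [Finset.prod_congr rfl fun k _ => hk k, ← Real.exp_sum]
  congr 1
  rw [Finset.sum_range, Finset.sum_neg_distrib, Finset.mul_sum, Finset.mul_sum]
  congr 1
  refine Finset.sum_congr rfl fun k _ => ?_
  ring

/-- The Laplace transform of the shot noise with path loss exponent twice the dimension. -/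
theorem integral_expNeg_tsum_invSq [IsProbabilityMeasure Pr]
    (hX : IsPoissonPointProcess X lam Pr) (hd : 1 ≤ d) (m : ℕ) :
    ∫ ω, expNeg (∑' x : X ω, ENNReal.ofReal ((‖(x : EuclideanSpace ℝ (Fin d))‖ ^ d) ^ 2)⁻¹) ^ m
      ∂Pr = Real.exp (-(lam * unitBallVolume d * √(Real.pi * m))) := by
  have h1 := ((tendsto_mul_sum_one_sub_exp (Nat.cast_nonneg m)).const_mul
    (lam * unitBallVolume d)).neg.rexp
  have h2 : Tendsto (fun n => ∫ ω, expNeg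
      (∑' x : X ω, dyadicInvSq n (‖(x : EuclideanSpace ℝ (Fin d))‖ ^ d)) ^ m ∂Pr) atTop
      (𝓝 (∫ ω, expNeg (∑' x : X ω,
        ENNReal.ofReal ((‖(x : EuclideanSpace ℝ (Fin d))‖ ^ d) ^ 2)⁻¹) ^ m ∂Pr)) := by
    refine tendsto_integral_of_dominated_convergence (fun _ => 1) (fun n => ?_)
      (integrable_const 1) (fun n => ae_of_all _ fun ω => ?_) (ae_of_all _ fun ω => ?_)
    · exact ((continuous_expNeg.measurable.comp
        (hX.measurable_tsum_dyadicInvSq n)).pow_const m).aestronglyMeasurable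
    · rw [Real.norm_of_nonneg (pow_nonneg (expNeg_nonneg _) m)]
      exact pow_le_one₀ (expNeg_nonneg _) (expNeg_le_one _)
    · exact ((continuous_expNeg.tendsto _).comp (tendsto_tsum_dyadicInvSq (X ω))).pow m
  simp_rw [hX.integral_expNeg_tsum_dyadicInvSq hd] at h2
  exact tendsto_nhds_unique h2 h1

/-- Both laws have transform exp(-λ c_d √(πm)) at every natural m. The constant π/2 is forced by
√(2mγ) = λ c_d √(πm). -/
theorem map_tsum_invSq [IsProbabilityMeasure Pr]
    (hX : IsPoissonPointProcess X lam Pr) (hd : 1 ≤ d) :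
    Pr.map (fun ω => ∑' x : X ω,
        ENNReal.ofReal ((‖(x : EuclideanSpace ℝ (Fin d))‖ ^ d) ^ 2)⁻¹) =
      (gaussianReal 0 1).map fun z =>
        ENNReal.ofReal (Real.pi / 2 * (lam * unitBallVolume d) ^ 2 / z ^ 2) := by
  have hm : Measurable fun z : ℝ =>
      ENNReal.ofReal (Real.pi / 2 * (lam * unitBallVolume d) ^ 2 / z ^ 2) := by fun_prop
  have := Measure.isProbabilityMeasure_map (μ := Pr) hX.measurable_tsum_invSq.aemeasurable
  have := Measure.isProbabilityMeasure_map (μ := gaussianReal 0 1) hm.aemeasurable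
  refine ext_of_integral_expNeg_pow fun n => ?_
  have hc : Continuous fun x => expNeg x ^ n := continuous_expNeg.pow n
  rw [integral_map hX.measurable_tsum_invSq.aemeasurable hc.aestronglyMeasurable,
    integral_map hm.aemeasurable hc.aestronglyMeasurable,
    hX.integral_expNeg_tsum_invSq hd]
  have h : ∀ z : ℝ, expNeg
      (ENNReal.ofReal (Real.pi / 2 * (lam * unitBallVolume d) ^ 2 / z ^ 2)) ^ n =
      Real.exp (-(n * (Real.pi / 2 * (lam * unitBallVolume d) ^ 2) / z ^ 2)) := by
    intro z
    rw [expNeg_ofReal (by positivity), ← Real.exp_nat_mul]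
    congr 1
    ring
  simp_rw [h]
  rw [integral_exp_neg_div_sq_gaussianReal (by positivity)]
  congr 2
  have hc : 0 ≤ lam * unitBallVolume d := mul_nonneg lam.2 (unitBallVolume_pos d).le
  rw [show 2 * (n * (Real.pi / 2 * (lam * unitBallVolume d) ^ 2)) =
    (lam * unitBallVolume d) ^ 2 * (Real.pi * n) by ring, Real.sqrt_mul (sq_nonneg _),
    Real.sqrt_sq hc]

end IsPoissonPointProcess

/-! ### The law of the interference. -/

theorem pathLoss_two_mul {d : ℕ} {r : ℝ} (hr : 0 < r) :
    pathLoss (2 * d) 0 r = ENNReal.ofReal ((r ^ d) ^ 2)⁻¹ := by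
  rw [pathLoss, if_pos hr.le, ENNReal.ofReal_rpow_of_pos hr, Real.rpow_neg hr.le, mul_comm,
    Real.rpow_mul hr.le, Real.rpow_natCast, Real.rpow_two]

theorem interferencePower_eq_mul_shotNoise {d : ℕ} (P α ε : ℝ)
    (X : Set (EuclideanSpace ℝ (Fin d))) :
    interferencePower P α ε X = ENNReal.ofReal P * shotNoise α ε X :=
  ENNReal.tsum_mul_left

/-- A point at the origin must be excluded: its path loss is ∞, while the real inverse square gives
0. -/
theorem shotNoise_two_mul {d : ℕ} {X : Set (EuclideanSpace ℝ (Fin d))} (h0 : 0 ∉ X) :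
    shotNoise (2 * d) 0 X =
      ∑' x : X, ENNReal.ofReal ((‖(x : EuclideanSpace ℝ (Fin d))‖ ^ d) ^ 2)⁻¹ :=
  tsum_congr fun x => pathLoss_two_mul (norm_pos_iff.2 fun h => h0 (h ▸ x.2))

namespace IsPoissonPointProcess

variable {Ω : Type*} [MeasurableSpace Ω] {d : ℕ} {X : Ω → Set (EuclideanSpace ℝ (Fin d))}
  {lam : ℝ≥0} {Pr : Measure Ω}

theorem ae_shotNoise_eq (hX : IsPoissonPointProcess X lam Pr) (hd : 1 ≤ d) :
    ∀ᵐ ω ∂Pr, shotNoise (2 * d) 0 (X ω) =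
      ∑' x : X ω, ENNReal.ofReal ((‖(x : EuclideanSpace ℝ (Fin d))‖ ^ d) ^ 2)⁻¹ := by
  have h := hX.ae_inter_eq_empty (isCompact_closedShell hd le_rfl (a := 0)) (by
    rw [volume_closedShell hd le_rfl le_rfl]; simp)
  filter_upwards [h] with ω hω
  refine shotNoise_two_mul fun h0 => ?_
  have : (0 : EuclideanSpace ℝ (Fin d)) ∈ X ω ∩ closedShell d 0 0 :=
    ⟨h0, by simp [closedShell, show d ≠ 0 by omega]⟩
  rw [hω] at this
  exact this

variable [IsProbabilityMeasure Pr]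

/-- The law is the image of a measure under the finite-valued `ENNReal.ofReal`, so it has no mass at
∞. -/
theorem ae_shotNoise_lt_top (hX : IsPoissonPointProcess X lam Pr) (hd : 1 ≤ d) :
    ∀ᵐ ω ∂Pr, shotNoise (2 * d) 0 (X ω) < ∞ := by
  have h : ∀ᵐ x ∂(Pr.map fun ω => ∑' x : X ω,
      ENNReal.ofReal ((‖(x : EuclideanSpace ℝ (Fin d))‖ ^ d) ^ 2)⁻¹), x < ∞ := by
    rw [hX.map_tsum_invSq hd, ae_map_iff (by fun_prop) measurableSet_Iio]
    exact ae_of_all _ fun _ => ENNReal.ofReal_lt_top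
  filter_upwards [hX.ae_shotNoise_eq hd,
    ae_of_ae_map hX.measurable_tsum_invSq.aemeasurable h] with ω h1 h2
  rwa [h1]

/-- Scaling γ/Z² by K scales γ. Taking K = 1 gives the shot noise, K = P the received power. -/
theorem hasLaw_mul_shotNoise (hX : IsPoissonPointProcess X lam Pr) (hd : 1 ≤ d) {K : ℝ}
    (hK : 0 ≤ K) :
    HasLaw (fun ω => K * (shotNoise (2 * d) 0 (X ω)).toReal)
      (levyMeasure (K * (Real.pi / 2 * ((lam : ℝ) * unitBallVolume d) ^ 2))) Pr := by
  have hm := hX.measurable_tsum_invSq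
  have hae : (fun ω => K * (shotNoise (2 * d) 0 (X ω)).toReal) =ᵐ[Pr]
      fun ω => K * (∑' x : X ω,
        ENNReal.ofReal ((‖(x : EuclideanSpace ℝ (Fin d))‖ ^ d) ^ 2)⁻¹).toReal := by
    filter_upwards [hX.ae_shotNoise_eq hd] with ω hω
    rw [hω]
  have hK' : Measurable fun y : ℝ≥0∞ => K * y.toReal := by fun_prop
  refine HasLaw.congr ⟨by fun_prop, ?_⟩ hae
  have h := Measure.map_map (μ := Pr) hK' hm
  refine h.symm.trans ?_
  rw [hX.map_tsum_invSq hd, Measure.map_map hK' (by fun_prop),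
    levyMeasure_eq_map_gaussianReal (by positivity)]
  congr 1
  ext z
  rw [Function.comp_apply, ENNReal.toReal_ofReal (by positivity)]
  ring

end IsPoissonPointProcess

/-! ### The outage probability. -/

/-- For z ≠ 0, γ/z² > s exactly when |z| < √(γ/s). -/
theorem levyMeasure_real_Ioi {γ s : ℝ} (hγ : 0 ≤ γ) (hs : 0 < s) :
    (levyMeasure γ).real (Ioi s) = 2 * stdNormalCDF √(γ / s) - 1 := by
  have : NullSingletonClass (gaussianReal 0 1) := nullSingletonClass_gaussianReal one_ne_zero
  rw [levyMeasure_eq_map_gaussianReal hγ, map_measureReal_apply (by fun_prop) measurableSet_Ioi,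
    ← gaussianReal_real_Ioo_neg (Real.sqrt_nonneg _)]
  refine measureReal_congr ?_
  -- The equivalence may fail at z = 0, where the quotient is 0 by convention.
  have h0 : ∀ᵐ z ∂(gaussianReal 0 1), z ≠ 0 := by
    rw [ae_iff]
    simp
  filter_upwards [h0] with z hz
  refine propext ?_
  change s < γ / z ^ 2 ↔ z ∈ Ioo (-√(γ / s)) √(γ / s)
  have hz2 : 0 < z ^ 2 := by positivity
  rw [mem_Ioo, ← abs_lt, Real.lt_sqrt (abs_nonneg z), sq_abs, lt_div_iff₀ hz2, lt_div_iff₀ hs,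
    mul_comm]

theorem sinr_lt_iff {d : ℕ} {P N u τ : ℝ} (hP : 0 < P) (hN : 0 ≤ N) (hu : 0 < u) (hτ : 0 < τ)
    {α ε : ℝ} (hε : ε ≤ u) {X : Set (EuclideanSpace ℝ (Fin d))}
    (hX : shotNoise α ε X < ∞) :
    sinr P N u α ε X < ENNReal.ofReal τ ↔
      u ^ (-α) / τ - N / P < (shotNoise α ε X).toReal := by
  set t := (shotNoise α ε X).toReal with ht
  have ht0 : 0 ≤ t := ENNReal.toReal_nonneg
  have hS : shotNoise α ε X = ENNReal.ofReal t := (ENNReal.ofReal_toReal hX.ne).symm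
  have hua : 0 < u ^ (-α) := Real.rpow_pos_of_pos hu _
  rw [sinr, interferencePower_eq_mul_shotNoise, hS, pathLoss, if_pos hε,
    ENNReal.ofReal_rpow_of_pos hu, ← ENNReal.ofReal_mul hP.le, ← ENNReal.ofReal_mul hP.le,
    ← ENNReal.ofReal_add (by positivity) hN]
  have key : u ^ (-α) / τ - N / P < t ↔ P * u ^ (-α) < τ * (P * t + N) := by
    rw [div_sub_div _ _ hτ.ne' hP.ne', div_lt_iff₀ (by positivity)]
    constructor <;> intro h <;> nlinarith
  rw [key]
  -- With zero denominator the ratio is ∞, and both sides of the equivalence are false.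
  rcases (by positivity : 0 ≤ P * t + N).eq_or_lt with h | h
  · have hne : ENNReal.ofReal (P * u ^ (-α)) ≠ 0 := by
      rw [Ne, ENNReal.ofReal_eq_zero, not_le]
      positivity
    rw [← h, ENNReal.ofReal_zero, ENNReal.div_zero hne, mul_zero]
    exact iff_of_false not_top_lt (by rw [not_lt]; positivity)
  · rw [← ENNReal.ofReal_div_of_pos h, ENNReal.ofReal_lt_ofReal_iff hτ, div_lt_iff₀ h]

theorem IsPoissonPointProcess.outageProbability_eq {Ω : Type*} [MeasurableSpace Ω] {d : ℕ}
    {X : Ω → Set (EuclideanSpace ℝ (Fin d))} {lam : ℝ≥0} {Pr : Measure Ω}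
    [IsProbabilityMeasure Pr] (hX : IsPoissonPointProcess X lam Pr) (hd : 1 ≤ d)
    {P N u τ : ℝ} (hP : 0 < P) (hN : 0 ≤ N) (hu : 0 < u) (hτ : 0 < τ)
    (hsnr : τ * N < P * u ^ (-(2 * d : ℝ))) :
    outageProbability P N u τ (2 * d) 0 X Pr =
      2 * stdNormalCDF (√((Real.pi / 2) / (u ^ (-(2 * (d : ℝ))) / τ - N / P))
        * unitBallVolume d * lam) - 1 := by
  have hs : 0 < u ^ (-(2 * (d : ℝ))) / τ - N / P := by
    rw [div_sub_div _ _ hτ.ne' hP.ne']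
    exact div_pos (by linarith) (by positivity)
  set s := u ^ (-(2 * (d : ℝ))) / τ - N / P
  have hc : 0 ≤ (lam : ℝ) * unitBallVolume d := mul_nonneg lam.2 (unitBallVolume_pos d).le
  have hlaw := hX.hasLaw_mul_shotNoise hd zero_le_one
  simp only [one_mul] at hlaw
  have hset : {ω | sinr P N u (2 * d) 0 (X ω) < ENNReal.ofReal τ} =ᵐ[Pr]
      {ω | s < (shotNoise (2 * d) 0 (X ω)).toReal} := by
    filter_upwards [hX.ae_shotNoise_lt_top hd] with ω hω
    exact propext (sinr_lt_iff hP hN hu hτ hu.le hω)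
  rw [outageProbability, measureReal_congr hset, measureReal_def,
    hlaw.measure_eq (p := fun y => s < y) measurableSet_Ioi, ← measureReal_def]
  refine (levyMeasure_real_Ioi (by positivity) hs).trans ?_
  -- As γ is quadratic in λ c_d, √(γ/s) is linear in λ.
  rw [mul_div_right_comm, Real.sqrt_mul (by positivity), Real.sqrt_sq hc, mul_assoc,
    mul_comm (lam : ℝ)]

/-! ### Inverting the outage probability. -/

section capacity

variable {q : ℝ≥0 → ℝ} {κ : ℝ}

theorem strictMono_of_eq_stdNormalCDF (hκ : 0 < κ)
    (hq : ∀ lam : ℝ≥0, q lam = 2 * stdNormalCDF (κ * lam) - 1) : StrictMono q := by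
  intro a b hab
  have : κ * a < κ * b := mul_lt_mul_of_pos_left (by exact_mod_cast hab) hκ
  have := strictMono_stdNormalCDF this
  rw [hq, hq]
  linarith

theorem range_eq_of_eq_stdNormalCDF (hκ : 0 < κ)
    (hq : ∀ lam : ℝ≥0, q lam = 2 * stdNormalCDF (κ * lam) - 1) : range q = Ico (q 0) 1 := by
  ext y
  constructor
  · rintro ⟨lam, rfl⟩
    refine ⟨(strictMono_of_eq_stdNormalCDF hκ hq).monotone zero_le, ?_⟩
    have := (bijOn_stdNormalCDF.mapsTo (mem_univ (κ * lam))).2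
    rw [hq]
    linarith
  · rintro ⟨h0, h1⟩
    rw [hq, NNReal.coe_zero, mul_zero, stdNormalCDF_zero] at h0
    -- Solving 2F - 1 = y gives F = (1 + y)/2, and y ≥ q(0) = 0 makes the solution nonnegative,
    -- hence an admissible intensity.
    obtain ⟨x, -, hx⟩ := bijOn_stdNormalCDF.surjOn
      (show (1 + y) / 2 ∈ Ioo (0 : ℝ) 1 from ⟨by linarith, by linarith⟩)
    have hx0 : 0 ≤ x := by
      rw [← strictMono_stdNormalCDF.le_iff_le, stdNormalCDF_zero, hx]
      linarith
    refine ⟨(x / κ).toNNReal, ?_⟩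
    rw [hq, Real.coe_toNNReal _ (by positivity), mul_div_cancel₀ _ hκ.ne', hx]
    ring

theorem transmissionCapacity_of_eq_stdNormalCDF (hκ : 0 < κ)
    (hq : ∀ lam : ℝ≥0, q lam = 2 * stdNormalCDF (κ * lam) - 1) {y : ℝ} (hy : y ∈ Ico (q 0) 1) :
    transmissionCapacity q y = κ⁻¹ * stdNormalInvCDF ((1 + y) / 2) * (1 - y) := by
  rw [← range_eq_of_eq_stdNormalCDF hκ hq] at hy
  have h := Function.invFun_eq hy
  rw [hq] at h
  have h1 : (1 + y) / 2 = stdNormalCDF (κ * (Function.invFun q y : ℝ≥0)) := by linarith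
  rw [transmissionCapacity, stdNormalInvCDF, h1,
    Function.leftInverse_invFun strictMono_stdNormalCDF.injective, inv_mul_cancel_left₀ hκ.ne']

end capacity

theorem mainTheorem2
    (d : ℕ) (hd : 1 ≤ d)
    (α : ℝ) (hδ : (d : ℝ) / α = 1 / 2)
    (P N u τ : ℝ) (hP : 0 < P) (hN : 0 ≤ N) (hu : 0 < u) (hτ : 0 < τ)
    -- the signal to noise ratio exceeds the threshold
    (hsnr : τ * N < P * u ^ (-α))
    -- one Poisson point process of interferers for every intensity
    (Ω : ℝ≥0 → Type*) [∀ lam, MeasurableSpace (Ω lam)]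
    (Pr : ∀ lam, Measure (Ω lam)) [∀ lam, IsProbabilityMeasure (Pr lam)]
    (X : ∀ lam, Ω lam → Set (EuclideanSpace ℝ (Fin d)))
    (hX : ∀ lam, IsPoissonPointProcess (X lam) lam (Pr lam))
    (q : ℝ≥0 → ℝ) (hq : ∀ lam, q lam = outageProbability P N u τ α 0 (X lam) (Pr lam)) :
    -- the aggregate interference is almost surely finite and Lévy-distributed
    (∀ lam : ℝ≥0,
      (∀ᵐ ω ∂(Pr lam), shotNoise α 0 (X lam ω) < ∞) ∧
      HasLaw (fun ω => (shotNoise α 0 (X lam ω)).toReal)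
        (levyMeasure (Real.pi / 2 * ((lam : ℝ) * unitBallVolume d) ^ 2)) (Pr lam) ∧
      HasLaw (fun ω => (interferencePower P α 0 (X lam ω)).toReal)
        (levyMeasure (P * (Real.pi / 2 * ((lam : ℝ) * unitBallVolume d) ^ 2))) (Pr lam)) ∧
    -- the exact outage probability
    (∀ lam : ℝ≥0,
      q lam = 2 * stdNormalCDF
        (Real.sqrt ((Real.pi / 2) / (u ^ (-(2 * (d : ℝ))) / τ - N / P))
          * unitBallVolume d * (lam : ℝ)) - 1) ∧
    -- the outage probability is invertible, so that the transmission capacity is well defined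
    (Continuous q ∧ StrictMono q ∧ range q = Ico (q 0) 1) ∧
    -- the exact transmission capacity
    (∀ qstar ∈ Ico (q 0) 1,
      transmissionCapacity q qstar =
        1 / unitBallVolume d
          * Real.sqrt ((u ^ (-(2 * (d : ℝ))) / τ - N / P) / (Real.pi / 2))
          * stdNormalInvCDF ((1 + qstar) / 2) * (1 - qstar)) := by
  have hα : α = 2 * d := by
    -- If α were 0, then d/α would be 0 by convention, not 1/2.
    have h0 : α ≠ 0 := by
      rintro rfl
      norm_num at hδ
    field_simp at hδ
    linarith
  subst hα
  have hs : 0 < u ^ (-(2 * (d : ℝ))) / τ - N / P := by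
    rw [div_sub_div _ _ hτ.ne' hP.ne']
    exact div_pos (by linarith) (by positivity)
  have hq' : ∀ lam : ℝ≥0, q lam = 2 * stdNormalCDF
      (√((Real.pi / 2) / (u ^ (-(2 * (d : ℝ))) / τ - N / P)) * unitBallVolume d * lam) - 1 :=
    fun lam => (hq lam).trans ((hX lam).outageProbability_eq hd hP hN hu hτ hsnr)
  have hc := unitBallVolume_pos d
  have hκ : 0 < √((Real.pi / 2) / (u ^ (-(2 * (d : ℝ))) / τ - N / P)) * unitBallVolume d :=
    mul_pos (Real.sqrt_pos.2 (by positivity)) hc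
  refine ⟨fun lam => ⟨(hX lam).ae_shotNoise_lt_top hd, ?_, ?_⟩, hq',
    ⟨?_, strictMono_of_eq_stdNormalCDF hκ hq', range_eq_of_eq_stdNormalCDF hκ hq'⟩,
    fun y hy => ?_⟩
  · simpa only [one_mul] using (hX lam).hasLaw_mul_shotNoise hd zero_le_one
  · simpa only [interferencePower_eq_mul_shotNoise, ENNReal.toReal_mul,
      ENNReal.toReal_ofReal hP.le] using (hX lam).hasLaw_mul_shotNoise hd hP.le
  · rw [funext hq']
    have := continuous_stdNormalCDF
    fun_prop
  · rw [transmissionCapacity_of_eq_stdNormalCDF hκ hq' hy, mul_inv, ← Real.sqrt_inv, inv_div,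
      mul_comm (√_), one_div]
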